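/- Let $N\ge 1$ be a fixed integer and let $S=\{1,2\}^N=\{(s_1,\ldots,s_N)\in\mathbb{N}^N : 1\le s_i\le 2 \text{ for all } i\}$. An $S$-alignment of $N$ sequences of lengths $\ell_1,\ldots,\ell_N$ is an $N\times k$ matrix, for some $k\ge 1$, with non-negative integer entries whose $i$-th row sums to $\ell_i$ for every $i$ and each of whose columns is an element of $S$. For all $\ell_1,\ldots,\ell_N\ge 0$ there are finitely many of them; let $a_S(\ell_1,\ldots,\ell_N)$ be their number. Put $$\phi=\frac{\sqrt5-1}{2},\qquad A=-\phi^{N-1}(1+\phi)^{N-1}(1+2\phi),\qquad h=N\Bigl(\frac{\phi}{1+3\phi+2\phi^2}\Bigr)^{N-1},\qquad b_0=\frac{1}{-\phi A\sqrt{(2\pi)^{N-1}h}}.$$ Then $$a_S(\ell,\ldots,\ell)\sim \phi^{-\ell N}\,b_0\,\ell^{(1-N)/2}\qquad(\ell\to\infty),$$ i.e. the quotient of the two sides tends to $1$. -/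

import Mathlib

/-- The matrix `A` with `N` rows and `k` columns is an `S`-alignment of `N` sequences of
lengths `len 0, …, len (N - 1)`: there is at least one column, row `i` sums to `len i`, and
every column is an element of the set `S` of allowable steps. -/
def IsAlignment {N : ℕ} (S : Set (Fin N → ℕ)) (len : Fin N → ℕ) {k : ℕ}
    (A : Matrix (Fin N) (Fin k) ℕ) : Prop :=
  1 ≤ k ∧ (∀ i, ∑ j, A i j = len i) ∧ ∀ j, A.col j ∈ S

/-- The set of all `S`-alignments, with any number `k` of columns. -/
def alignments {N : ℕ} (S : Set (Fin N → ℕ)) (len : Fin N → ℕ) :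
    Set (Σ k : ℕ, Matrix (Fin N) (Fin k) ℕ) :=
  {A | IsAlignment S len A.2}

/-- The number of `S`-alignments of `N` sequences of the given lengths
(meaningful when that set is finite, as it is if `S` does not contain the zero vector). -/
noncomputable def numAlignments {N : ℕ} (S : Set (Fin N → ℕ)) (len : Fin N → ℕ) : ℕ :=
  (alignments S len).ncard

/-- The set of steps `{1,2}^N`. -/
def oneTwoSteps (N : ℕ) : Set (Fin N → ℕ) :=
  {s | ∀ i, 1 ≤ s i ∧ s i ≤ 2}

/-! An alignment with `k` columns has independent rows, each a word in {1, 2} of length `k` and sum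
`l`, so the count is the sum over `k` of `C(k, l-k)^N`. Let steps 1 and 2 have probabilities `φ` and
`φ²`, which add up to 1. Then `φ^l C(k, l-k)` is the probability that the walk is at `l` after `k`
steps, and the problem becomes the asymptotics of the sum of `N`-th powers of these probabilities.

By the local limit theorem (`tendsto_sqrt_mul_binomialWeight`), `√l` times the probability at `k ≈
l/(1+φ²) + √l x` tends to a Gaussian `G x`. No separate tail estimates are needed. For `N = 1` the
sum is a scaled Fibonacci number, whose limit `1/(1+φ²)` equals `∫ G`, so no mass escapes. Scheffé's
argument then gives L¹ convergence, and a uniform bound carries it over to `N`-th powers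
(`tendsto_integral_pow_of_tendsto_integral`). The constant is `∫ G^N`. -/

section

open Finset

/-! ### Counting alignments by their number of columns -/

/-- The sequences of `k` terms in `{1, 2}` with sum `L`. -/
def oneTwoRows (k L : ℕ) : Finset (Fin k → ℕ) :=
  (Fintype.piFinset fun _ : Fin k => ({1, 2} : Finset ℕ)).filter fun r => ∑ j, r j = L

theorem mem_oneTwoRows {k L : ℕ} {r : Fin k → ℕ} :
    r ∈ oneTwoRows k L ↔ (∀ j, 1 ≤ r j ∧ r j ≤ 2) ∧ ∑ j, r j = L := by
  simp only [oneTwoRows, mem_filter, Fintype.mem_piFinset, mem_insert, mem_singleton]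
  refine and_congr_left fun _ => forall_congr' fun j => ?_
  omega

/-- A row is determined by the positions of its 2s, of which there are `L - k`. -/
theorem card_oneTwoRows {k L : ℕ} (h : k ≤ L) : (oneTwoRows k L).card = k.choose (L - k) := by
  have hsum (s : Finset (Fin k)) : ∑ j, (if j ∈ s then 2 else 1) = k + s.card := by
    have : ∀ j, (if j ∈ s then 2 else 1) = 1 + if j ∈ s then 1 else 0 := by
      intro j; split_ifs <;> rfl
    simp [this, sum_add_distrib]
  have hinv {r : Fin k → ℕ} (hr : r ∈ oneTwoRows k L) :
      (fun j => if j ∈ univ.filter (fun j => r j = 2) then 2 else 1) = r := by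
    funext j
    have := (mem_oneTwoRows.1 hr).1 j
    simp only [mem_filter, mem_univ, true_and]
    split_ifs <;> omega
  rw [show k.choose (L - k) = (powersetCard (L - k) (univ : Finset (Fin k))).card by simp]
  refine card_nbij' (fun r => univ.filter fun j => r j = 2)
    (fun s j => if j ∈ s then 2 else 1) ?_ ?_ ?_ ?_
  · intro r hr
    have hr : r ∈ oneTwoRows k L := hr
    have h1 := hsum (univ.filter fun j => r j = 2)
    have h2 := congrArg (fun f : Fin k → ℕ => ∑ j, f j) (hinv hr)
    have h3 := (mem_oneTwoRows.1 hr).2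
    refine mem_powersetCard.2 ⟨subset_univ _, ?_⟩
    exact Nat.eq_sub_of_add_eq' (h1.symm.trans (h2.trans h3))
  · intro s hs
    have hs := (mem_powersetCard.1 hs).2
    refine mem_oneTwoRows.2 ⟨fun j => ?_, ?_⟩
    · dsimp only
      split_ifs <;> omega
    · rw [hsum, hs]
      omega
  · intro r hr
    exact hinv hr
  · intro s _
    ext j
    by_cases h : j ∈ s <;> simp [h]

/-- The matrices with `k` columns and entries in `{1, 2}` with row sums `len`. -/
def oneTwoMatrices {N : ℕ} (len : Fin N → ℕ) (k : ℕ) : Finset (Matrix (Fin N) (Fin k) ℕ) :=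
  Fintype.piFinset fun a => oneTwoRows k (len a)

theorem mem_oneTwoMatrices {N k : ℕ} {len : Fin N → ℕ} {M : Matrix (Fin N) (Fin k) ℕ} :
    M ∈ oneTwoMatrices len k ↔ ∀ a, (∀ j, 1 ≤ M a j ∧ M a j ≤ 2) ∧ ∑ j, M a j = len a :=
  Fintype.mem_piFinset.trans (forall_congr' fun _ => mem_oneTwoRows)

theorem card_oneTwoMatrices {N k L : ℕ} (h : k ≤ L) :
    (oneTwoMatrices (fun _ : Fin N => L) k).card = k.choose (L - k) ^ N :=
  (Fintype.card_piFinset _).trans (by simp [card_oneTwoRows h])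

theorem alignments_oneTwoSteps_eq {N : ℕ} (len : Fin N → ℕ) (i : Fin N) :
    alignments (oneTwoSteps N) len =
      ((Icc 1 (len i)).sigma (oneTwoMatrices len) : Set (Σ k : ℕ, Matrix (Fin N) (Fin k) ℕ)) := by
  ext ⟨k, M⟩
  rw [mem_coe, mem_sigma, mem_oneTwoMatrices, mem_Icc]
  constructor
  · rintro ⟨h1, h2, h3⟩
    refine ⟨⟨h1, ?_⟩, fun a => ⟨fun j => h3 j a, h2 a⟩⟩
    calc k = ∑ _j : Fin k, 1 := by simp
      _ ≤ ∑ j, M i j := sum_le_sum fun j _ => (h3 j i).1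
      _ = len i := h2 i
  · rintro ⟨⟨h1, -⟩, h2⟩
    exact ⟨h1, fun a => (h2 a).2, fun j a => (h2 a).1 j⟩

theorem finite_alignments_oneTwoSteps {N : ℕ} (hN : 1 ≤ N) (len : Fin N → ℕ) :
    (alignments (oneTwoSteps N) len).Finite := by
  rw [alignments_oneTwoSteps_eq len ⟨0, hN⟩]
  exact finite_toSet _

theorem numAlignments_oneTwoSteps {N : ℕ} (hN : 1 ≤ N) {l : ℕ} (hl : 1 ≤ l) :
    numAlignments (oneTwoSteps N) (fun _ => l) = ∑ k ∈ range (l + 1), k.choose (l - k) ^ N := by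
  -- The term `k = 0` may be adjoined: it vanishes because `l` and `N` are positive.
  rw [numAlignments, alignments_oneTwoSteps_eq _ ⟨0, hN⟩, Set.ncard_coe_finset, card_sigma,
    range_eq_Ico, sum_eq_sum_Ico_succ_bot (Nat.succ_pos l), Nat.choose_eq_zero_of_lt (by omega),
    zero_pow (by omega), zero_add]
  refine sum_congr (by ext; simp) fun k hk => ?_
  exact card_oneTwoMatrices (by simp only [mem_Ico] at hk; omega)

end

/-! ### The local limit theorem by Fourier inversion -/

open Filter Topology MeasureTheory

/-- The probability that `k` independent trials with success probability `q` have `m` successes. -/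
noncomputable def binomialWeight (q : ℝ) (k m : ℕ) : ℝ :=
  k.choose m * (1 - q) ^ (k - m) * q ^ m

/-- The characteristic function of a centred Bernoulli variable. -/
noncomputable def bernoulliChar (q t : ℝ) : ℂ :=
  (1 - q) * Complex.exp (-(q * t) * Complex.I) + q * Complex.exp ((1 - q) * t * Complex.I)

theorem continuous_bernoulliChar (q : ℝ) : Continuous (bernoulliChar q) := by
  unfold bernoulliChar
  fun_prop

theorem integral_exp_int_mul_I (n : ℤ) :
    ∫ t in (-Real.pi)..Real.pi, Complex.exp (n * t * Complex.I) =
      if n = 0 then (2 * Real.pi : ℂ) else 0 := by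
  split_ifs with h
  · simp [h]; ring
  · have hn : (n : ℂ) * Complex.I ≠ 0 := by simp [h]
    have : ∀ t : ℝ, (n : ℂ) * t * Complex.I = n * Complex.I * t := fun t => by ring
    simp_rw [this]
    rw [integral_exp_mul_complex hn, div_eq_zero_iff, sub_eq_zero, Complex.exp_eq_exp_iff_exists_int]
    exact .inl ⟨n, by push_cast; ring⟩

/-- Expand the power by the binomial theorem; orthogonality keeps only `j = m`. For `m > k` both
sides vanish. -/
theorem integral_bernoulliChar (q : ℝ) (k m : ℕ) :
    ∫ t in (-Real.pi)..Real.pi,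
      bernoulliChar q t ^ k * Complex.exp (-((m - k * q : ℝ) * t) * Complex.I) =
      2 * Real.pi * binomialWeight q k m := by
  have key (t : ℝ) : bernoulliChar q t ^ k * Complex.exp (-((m - k * q : ℝ) * t) * Complex.I) =
      ∑ j ∈ Finset.range (k + 1), (binomialWeight q k j : ℂ) *
        Complex.exp (((j - m : ℤ) : ℂ) * t * Complex.I) := by
    rw [bernoulliChar, add_comm, add_pow, Finset.sum_mul]
    refine Finset.sum_congr rfl fun j hj => ?_
    have hj : j ≤ k := by simp at hj; omega
    rw [mul_pow, mul_pow, ← Complex.exp_nat_mul, ← Complex.exp_nat_mul, binomialWeight]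
    have : Complex.exp (((j - m : ℤ) : ℂ) * t * Complex.I) =
      Complex.exp (j * ((1 - q) * t * Complex.I)) *
        Complex.exp ((k - j : ℕ) * (-(q * t) * Complex.I)) *
        Complex.exp (-((m - k * q : ℝ) * t) * Complex.I) := by
      rw [← Complex.exp_add, ← Complex.exp_add]
      congr 1
      push_cast [Nat.cast_sub hj]
      ring
    rw [this]
    push_cast
    ring
  simp_rw [key]
  rw [intervalIntegral.integral_finsetSum]
  · simp_rw [intervalIntegral.integral_const_mul, integral_exp_int_mul_I, sub_eq_zero, Nat.cast_inj,
      mul_ite, mul_zero, Finset.sum_ite_eq', Finset.mem_range]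
    split_ifs with h
    · ring
    · rw [binomialWeight, Nat.choose_eq_zero_of_lt (by omega)]
      simp
  · intro j _
    exact Continuous.intervalIntegrable (by fun_prop) _ _

/-- The squared norm is exactly `1 - 2q(1-q)(1 - cos t)`, and `cos t ≤ 1 - 2t²/π²` on `[-π, π]`. At
`t = s/√k` the `k`-th power of the bound is free of `k`, which supplies the dominating function
below. -/
theorem norm_bernoulliChar_le {q t : ℝ} (hq0 : 0 ≤ q) (hq1 : q ≤ 1) (ht : |t| ≤ Real.pi) :
    ‖bernoulliChar q t‖ ≤ Real.exp (-(2 * (q * (1 - q)) / Real.pi ^ 2) * t ^ 2) := by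
  have hsq : ‖bernoulliChar q t‖ ^ 2 = 1 - 2 * (q * (1 - q)) * (1 - Real.cos t) := by
    have h1 : bernoulliChar q t =
        (((1 - q) * Real.cos (q * t) + q * Real.cos ((1 - q) * t) : ℝ) : ℂ) +
        ((-(1 - q) * Real.sin (q * t) + q * Real.sin ((1 - q) * t) : ℝ) : ℂ) * Complex.I := by
      rw [bernoulliChar, Complex.exp_mul_I, Complex.exp_mul_I, Complex.cos_neg, Complex.sin_neg]
      push_cast
      ring
    have h2 : Real.cos t = Real.cos (q * t) * Real.cos ((1 - q) * t) -
        Real.sin (q * t) * Real.sin ((1 - q) * t) := by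
      rw [← Real.cos_add]; ring_nf
    rw [← Complex.normSq_eq_norm_sq, h1, Complex.normSq_add_mul_I, h2]
    linear_combination (1 - q) ^ 2 * Real.sin_sq_add_cos_sq (q * t) +
      q ^ 2 * Real.sin_sq_add_cos_sq ((1 - q) * t)
  have hcos := Real.cos_le_one_sub_mul_cos_sq ht
  have hv : 0 ≤ q * (1 - q) := mul_nonneg hq0 (by linarith)
  rw [← pow_le_pow_iff_left₀ (norm_nonneg _) (Real.exp_nonneg _) two_ne_zero, hsq,
    ← Real.exp_nat_mul]
  refine le_trans ?_ (Real.add_one_le_exp _)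
  have := mul_le_mul_of_nonneg_left hcos hv
  push_cast
  linear_combination 2 * this

theorem tendsto_natCast_mul_exp_div_sqrt (c : ℂ) :
    Tendsto (fun k : ℕ => (k : ℂ) * (Complex.exp (c / √k) - 1 - c / √k)) atTop
      (𝓝 (c ^ 2 / 2)) := by
  have hz : Tendsto (fun k : ℕ => c / (√(k : ℝ) : ℂ)) atTop (𝓝 0) := by
    have : Tendsto (fun k : ℕ => (((√(k : ℝ))⁻¹ : ℝ) : ℂ)) atTop (𝓝 ((0 : ℝ) : ℂ)) :=
      (Complex.continuous_ofReal.tendsto 0).comp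
        (tendsto_inv_atTop_zero.comp (Real.tendsto_sqrt_atTop.comp tendsto_natCast_atTop_atTop))
    simpa [div_eq_mul_inv] using this.const_mul c
  have hsq {k : ℕ} (hk : 0 < k) : (c / (√(k : ℝ) : ℂ)) ^ 2 = c ^ 2 / k := by
    rw [div_pow, ← Complex.ofReal_pow, Real.sq_sqrt (by positivity), Complex.ofReal_natCast]
  have hO : ((fun x : ℂ => x ^ 2) ∘ fun k : ℕ => c / (√(k : ℝ) : ℂ)) =O[atTop]
      fun k : ℕ => (k : ℂ)⁻¹ := by
      refine .of_bound (‖c ^ 2‖) ?_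
      filter_upwards [eventually_gt_atTop 0] with k hk
      rw [Function.comp_apply, hsq hk, div_eq_mul_inv, norm_mul]
  have ho := ((Complex.exp_sub_sum_range_succ_isLittleO_pow 2).comp_tendsto hz).trans_isBigO hO
  have ht := (ho.tendsto_inv_smul_nhds_zero.add_const (c ^ 2 / 2))
  rw [zero_add] at ht
  refine ht.congr' ?_
  filter_upwards [eventually_gt_atTop 0] with k hk
  have hk' : (k : ℂ) ≠ 0 := by exact_mod_cast hk.ne'
  have := hsq hk
  simp only [Function.comp_apply, Finset.sum_range_succ, Finset.sum_range_zero, this, inv_inv,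
    smul_eq_mul]
  simp
  field_simp
  ring

/-- Centring cancels the first-order terms, so `k` times the deviation from 1 tends to
`-q(1-q)s²/2`. -/
theorem tendsto_bernoulliChar_pow (q s : ℝ) :
    Tendsto (fun k : ℕ => bernoulliChar q (s / √k) ^ k) atTop
      (𝓝 (Complex.exp (-(q * (1 - q) / 2 : ℝ) * s ^ 2))) := by
  have h := ((tendsto_natCast_mul_exp_div_sqrt (-(q * s) * Complex.I)).const_mul (1 - q : ℂ)).add
    ((tendsto_natCast_mul_exp_div_sqrt ((1 - q) * s * Complex.I)).const_mul (q : ℂ))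
  have h2 := Complex.tendsto_one_add_pow_exp_of_tendsto (g := fun k : ℕ =>
    bernoulliChar q (s / √k) - 1) (h.congr fun k => ?_)
  · convert h2 using 3
    · ring
    · push_cast
      ring_nf
      simp
      ring
  · rw [bernoulliChar]
    push_cast
    ring_nf

/-- Substitute `t = s/√k`. The indicator puts all `k` on the same domain, ready for dominated
convergence. -/
theorem sqrt_mul_binomialWeight (q : ℝ) {k : ℕ} (hk : 0 < k) (m : ℕ) :
    ((√k * binomialWeight q k m : ℝ) : ℂ) = ((2 * Real.pi)⁻¹ : ℝ) *
      ∫ s : ℝ, (Set.Ioc (-(Real.pi * √k)) (Real.pi * √k)).indicator (fun s : ℝ =>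
        bernoulliChar q (s / √k) ^ k *
          Complex.exp (-(((m - k * q) / √k : ℝ) * s) * Complex.I)) s := by
  have hk' : √(k : ℝ) ≠ 0 := by positivity
  have hpi := Real.pi_pos
  have h := intervalIntegral.integral_comp_div (a := -(Real.pi * √k)) (b := Real.pi * √k)
    (fun t : ℝ => bernoulliChar q t ^ k * Complex.exp (-((m - k * q : ℝ) * t) * Complex.I)) hk'
  rw [neg_div, mul_div_cancel_right₀ _ hk', integral_bernoulliChar,
    intervalIntegral.integral_of_le (neg_le_self (by positivity)),
    ← integral_indicator measurableSet_Ioc] at h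
  have hint : ∀ s : ℝ, -(((m - k * q : ℝ) : ℂ) * ((s / √k : ℝ) : ℂ)) * Complex.I =
      -(((m - k * q) / √k : ℝ) * s) * Complex.I := fun s => by
    push_cast
    ring
  simp_rw [hint] at h
  rw [h, Complex.real_smul]
  push_cast
  field_simp

theorem norm_integrand_le {q : ℝ} (hq0 : 0 ≤ q) (hq1 : q ≤ 1) (k : ℕ) (y s : ℝ) :
    ‖(Set.Ioc (-(Real.pi * √k)) (Real.pi * √k)).indicator (fun s : ℝ =>
        bernoulliChar q (s / √k) ^ k * Complex.exp (-(y * s) * Complex.I)) s‖ ≤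
      Real.exp (-(2 * (q * (1 - q)) / Real.pi ^ 2) * s ^ 2) := by
  rw [Set.indicator_apply]
  split_ifs with hs
  · have hk : 0 < √(k : ℝ) := by
      by_contra! h
      have : √(k : ℝ) = 0 := le_antisymm h (Real.sqrt_nonneg _)
      simp [this] at hs
    have h1 : ‖Complex.exp (-(y * s) * Complex.I)‖ = 1 := by
      exact_mod_cast Complex.norm_exp_ofReal_mul_I (-(y * s))
    rw [norm_mul, h1, mul_one, norm_pow]
    refine (pow_le_pow_left₀ (norm_nonneg _) (norm_bernoulliChar_le hq0 hq1 ?_) k).trans_eq ?_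
    · rw [abs_div, abs_of_pos hk, div_le_iff₀ hk, abs_le]
      exact ⟨hs.1.le, hs.2⟩
    · rw [← Real.exp_nat_mul, div_pow, Real.sq_sqrt (by positivity)]
      have : (k : ℝ) ≠ 0 := (Real.sqrt_pos.1 hk).ne'
      congr 1
      field_simp
  · simpa using Real.exp_nonneg _

theorem exists_sqrt_mul_binomialWeight_le {q : ℝ} (hq0 : 0 < q) (hq1 : q < 1) :
    ∃ C : ℝ, ∀ k m : ℕ, √k * binomialWeight q k m ≤ C := by
  refine ⟨(2 * Real.pi)⁻¹ * ∫ s : ℝ, Real.exp (-(2 * (q * (1 - q)) / Real.pi ^ 2) * s ^ 2),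
    fun k m => ?_⟩
  have hpi := Real.pi_pos
  have hb : 0 < 2 * (q * (1 - q)) / Real.pi ^ 2 := by
    have : 0 < 1 - q := by linarith
    positivity
  rcases k.eq_zero_or_pos with rfl | hk
  · rw [integral_gaussian]
    simp only [Nat.cast_zero, Real.sqrt_zero, zero_mul]
    positivity
  refine (Complex.norm_real _ ▸ le_abs_self _ : _ ≤ ‖((√k * binomialWeight q k m : ℝ) : ℂ)‖).trans ?_
  rw [sqrt_mul_binomialWeight q hk m, norm_mul, Complex.norm_real,
    Real.norm_of_nonneg (by positivity)]
  gcongr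
  exact norm_integral_le_of_norm_le (integrable_exp_neg_mul_sq hb)
    (.of_forall fun s => norm_integrand_le hq0.le hq1.le k _ s)

/-- The local limit theorem of de Moivre and Laplace. -/
theorem tendsto_sqrt_mul_binomialWeight {q : ℝ} (hq0 : 0 < q) (hq1 : q < 1) {k m : ℕ → ℕ} {y : ℝ}
    (hk : Tendsto k atTop atTop)
    (hy : Tendsto (fun n => ((m n - k n * q) / √(k n) : ℝ)) atTop (𝓝 y)) :
    Tendsto (fun n => √(k n) * binomialWeight q (k n) (m n)) atTop
      (𝓝 ((√(2 * Real.pi * (q * (1 - q))))⁻¹ * Real.exp (-y ^ 2 / (2 * (q * (1 - q)))))) := by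
  have hpi := Real.pi_pos
  have hv : 0 < q * (1 - q) := mul_pos hq0 (by linarith)
  have hlim : Tendsto (fun n => ∫ s : ℝ,
      (Set.Ioc (-(Real.pi * √(k n))) (Real.pi * √(k n))).indicator (fun s : ℝ =>
        bernoulliChar q (s / √(k n)) ^ (k n) *
          Complex.exp (-(((m n - k n * q) / √(k n) : ℝ) * s) * Complex.I)) s) atTop
      (𝓝 (∫ s : ℝ, Complex.exp (-(q * (1 - q) / 2 : ℝ) * s ^ 2) *
        Complex.exp (-(y * s) * Complex.I))) := by
    refine tendsto_integral_of_dominated_convergence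
      (fun s => Real.exp (-(2 * (q * (1 - q)) / Real.pi ^ 2) * s ^ 2)) ?_
      (integrable_exp_neg_mul_sq (by positivity))
      (fun n => .of_forall fun s => norm_integrand_le hq0.le hq1.le _ _ s)
      (.of_forall fun s => ?_)
    · intro n
      refine (Continuous.aestronglyMeasurable ?_).indicator measurableSet_Ioc
      have := continuous_bernoulliChar q
      fun_prop
    · have h1 := ((tendsto_bernoulliChar_pow q s).comp hk).mul
        ((Complex.continuous_exp.tendsto _).comp
          ((((Complex.continuous_ofReal.tendsto _).comp hy).mul_const (s : ℂ)).neg.mul_const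
            Complex.I))
      refine h1.congr' ?_
      have h2 : Tendsto (fun n => Real.pi * √(k n)) atTop atTop :=
        (Real.tendsto_sqrt_atTop.comp (tendsto_natCast_atTop_atTop.comp hk)).const_mul_atTop hpi
      filter_upwards [h2.eventually_gt_atTop |s|] with n hn
      rw [Set.indicator_of_mem]
      · simp
      · exact ⟨(abs_lt.1 hn).1, (abs_lt.1 hn).2.le⟩
  have hgauss : ∫ s : ℝ, Complex.exp (-(q * (1 - q) / 2 : ℝ) * s ^ 2) *
        Complex.exp (-(y * s) * Complex.I) =
      (((2 * Real.pi) * ((√(2 * Real.pi * (q * (1 - q))))⁻¹ *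
        Real.exp (-y ^ 2 / (2 * (q * (1 - q))))) : ℝ) : ℂ) := by
    have h := fourierIntegral_gaussian (b := (q * (1 - q) / 2 : ℝ))
      (by rw [Complex.ofReal_re]; positivity) (-y)
    have h3 : ∀ s : ℝ, Complex.exp (-(q * (1 - q) / 2 : ℝ) * s ^ 2) *
        Complex.exp (-(y * s) * Complex.I) = Complex.exp (Complex.I * -y * s) *
        Complex.exp (-(q * (1 - q) / 2 : ℝ) * s ^ 2) := fun s => by
      rw [mul_comm]; congr 2; ring
    simp_rw [h3]
    rw [h]
    have h4 : (Real.pi / (q * (1 - q) / 2 : ℝ) : ℂ) ^ (1 / 2 : ℂ) =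
        ((2 * Real.pi * (√(2 * Real.pi * (q * (1 - q))))⁻¹ : ℝ) : ℂ) := by
      have : Real.sqrt (Real.pi / (q * (1 - q) / 2)) =
          2 * Real.pi * (√(2 * Real.pi * (q * (1 - q))))⁻¹ := by
        rw [Real.sqrt_eq_iff_mul_self_eq (by positivity) (by positivity)]
        have := Real.mul_self_sqrt (show 0 ≤ 2 * Real.pi * (q * (1 - q)) by positivity)
        have h5 : √(2 * Real.pi * (q * (1 - q))) ≠ 0 := by positivity
        rw [mul_mul_mul_comm, ← mul_inv, this]
        field_simp
      rw [← this, Real.sqrt_eq_rpow, Complex.ofReal_cpow (by positivity)]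
      push_cast
      rfl
    rw [h4]
    push_cast
    rw [mul_assoc]
    congr 3
    field_simp
    ring
  rw [hgauss] at hlim
  have h := (Complex.continuous_re.tendsto _).comp (hlim.const_mul (((2 * Real.pi)⁻¹ : ℝ) : ℂ))
  rw [← Complex.ofReal_mul, Complex.ofReal_re, inv_mul_cancel_left₀ (by positivity)] at h
  refine h.congr' ?_
  filter_upwards [hk.eventually_gt_atTop 0] with n hn
  rw [Function.comp_apply, ← sqrt_mul_binomialWeight q hn, Complex.ofReal_re]

/-! ### From pointwise convergence to integrals of powers -/

/-- A version of Scheffé's lemma for powers of a uniformly bounded sequence. -/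
theorem tendsto_integral_pow_of_tendsto_integral {α : Type*} [MeasurableSpace α] {μ : Measure α}
    {g : ℕ → α → ℝ} {G : α → ℝ} {C : ℝ}
    (hg0 : ∀ n x, 0 ≤ g n x) (hgC : ∀ n x, g n x ≤ C) (hG : Integrable G μ)
    (hg : ∀ n, Integrable (g n) μ) (hlim : ∀ x, Tendsto (fun n => g n x) atTop (𝓝 (G x)))
    (hint : Tendsto (fun n => ∫ x, g n x ∂μ) atTop (𝓝 (∫ x, G x ∂μ))) {N : ℕ} (hN : 1 ≤ N) :
    Tendsto (fun n => ∫ x, g n x ^ N ∂μ) atTop (𝓝 (∫ x, G x ^ N ∂μ)) := by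
  have hG0 x : 0 ≤ G x := ge_of_tendsto' (hlim x) fun n => hg0 n x
  have hGC x : G x ≤ C := le_of_tendsto' (hlim x) fun n => hgC n x
  have hpow {f : α → ℝ} (hf : Integrable f μ) (h0 : ∀ x, 0 ≤ f x) (hC : ∀ x, f x ≤ C) :
      Integrable (fun x => f x ^ N) μ := by
    refine (hf.const_mul (C ^ (N - 1))).mono' (hf.aestronglyMeasurable.pow N)
      (.of_forall fun x => ?_)
    rw [Real.norm_of_nonneg (pow_nonneg (h0 x) N)]
    obtain ⟨M, rfl⟩ := Nat.exists_eq_add_of_le' hN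
    rw [pow_succ, Nat.add_sub_cancel]
    exact mul_le_mul_of_nonneg_right (pow_le_pow_left₀ (h0 x) (hC x) M) (h0 x)
  -- The positive part of `G - g n` is dominated by `G`, since `g n ≥ 0`.
  have hneg : Tendsto (fun n => ∫ x, max (G x - g n x) 0 ∂μ) atTop (𝓝 0) := by
    have := tendsto_integral_of_dominated_convergence (μ := μ) (f := fun _ => (0 : ℝ))
      (F := fun n x => max (G x - g n x) 0) G
      (fun n => (hG.sub (hg n)).pos_part.aestronglyMeasurable) hG
      (fun n => .of_forall fun x => ?_) (.of_forall fun x => ?_)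
    · simpa using this
    · rw [Real.norm_of_nonneg (le_max_right _ _)]
      exact max_le (by linarith [hg0 n x]) (hG0 x)
    · simpa using ((hlim x).const_sub (G x)).max (tendsto_const_nhds (x := (0 : ℝ)))
  -- Uses `|u| = u + 2 max(-u, 0)` with `u = g n - G`.
  have habs : Tendsto (fun n => ∫ x, |g n x - G x| ∂μ) atTop (𝓝 0) := by
    have h := (hint.sub_const (∫ x, G x ∂μ)).add (hneg.const_mul 2)
    rw [sub_self, mul_zero, add_zero] at h
    refine h.congr fun n => ?_
    have h1 : Integrable (fun x => g n x - G x) μ := (hg n).sub hG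
    have h2 : Integrable (fun x => 2 * max (G x - g n x) 0) μ :=
      (hG.sub (hg n)).pos_part.const_mul 2
    rw [← integral_sub (hg n) hG, ← integral_const_mul, ← integral_add h1 h2]
    refine integral_congr_ae (.of_forall fun x => ?_)
    dsimp only
    rcases le_total (g n x) (G x) with hx | hx
    · rw [max_eq_left (by linarith), abs_of_nonpos (by linarith)]; ring
    · rw [max_eq_right (by linarith), abs_of_nonneg (by linarith)]; ring
  rw [← tendsto_sub_nhds_zero_iff]
  -- On `[0, C]` the `N`-th power is Lipschitz with constant `N C^(N-1)`.
  refine squeeze_zero_norm (fun n => ?_) (by simpa using habs.mul_const (N * C ^ (N - 1)))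
  rw [← integral_sub (hpow (hg n) (hg0 n) (hgC n)) (hpow hG hG0 hGC), ← integral_mul_const]
  refine norm_integral_le_of_norm_le (((hg n).sub hG).abs.mul_const _) (.of_forall fun x => ?_)
  rw [Real.norm_eq_abs, ← mul_assoc]
  refine (abs_pow_sub_pow_le _ _ _).trans ?_
  gcongr
  · rw [abs_of_nonneg (hg0 n x), abs_of_nonneg (hG0 x)]
    exact max_le (hgC n x) (hGC x)

/-! ### Sums as integrals of step functions -/

open Classical in
/-- The function that is `a k` on `[k, k + 1)` for `k < n` and vanishes elsewhere. -/
noncomputable def stepFun (n : ℕ) (a : ℕ → ℝ) (y : ℝ) : ℝ :=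
  if 0 ≤ y ∧ ⌊y⌋₊ < n then a ⌊y⌋₊ else 0

theorem stepFun_pow {N : ℕ} (hN : 1 ≤ N) (n : ℕ) (a : ℕ → ℝ) (y : ℝ) :
    stepFun n a y ^ N = stepFun n (fun k => a k ^ N) y := by
  unfold stepFun
  split_ifs
  · rfl
  · exact zero_pow (by omega)

theorem stepFun_eq_sum (n : ℕ) (a : ℕ → ℝ) :
    stepFun n a = fun y => ∑ k ∈ Finset.range n,
      (Set.Ico (k : ℝ) (k + 1)).indicator (fun _ => a k) y := by
  funext y
  by_cases hy : 0 ≤ y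
  · simp only [Set.indicator_apply, Set.mem_Ico, ← Nat.floor_eq_iff hy, stepFun, hy, true_and,
      Finset.sum_ite_eq, Finset.mem_range]
  · rw [stepFun, if_neg (fun h => hy h.1)]
    refine (Finset.sum_eq_zero fun k _ => Set.indicator_of_notMem (fun h => hy ?_) _).symm
    exact (Nat.cast_nonneg k).trans h.1

theorem integrable_indicator_Ico_const (u v c : ℝ) :
    Integrable ((Set.Ico u v).indicator fun _ => c) :=
  (integrable_indicator_iff measurableSet_Ico).2 (integrableOn_const (by simp))

theorem integrable_stepFun (n : ℕ) (a : ℕ → ℝ) : Integrable (stepFun n a) := by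
  rw [stepFun_eq_sum]
  exact integrable_finsetSum _ fun k _ => integrable_indicator_Ico_const _ _ _

theorem integral_stepFun (n : ℕ) (a : ℕ → ℝ) :
    ∫ y, stepFun n a y = ∑ k ∈ Finset.range n, a k := by
  rw [stepFun_eq_sum, integral_finsetSum]
  · refine Finset.sum_congr rfl fun k _ => ?_
    rw [integral_indicator_const _ measurableSet_Ico]
    simp
  · exact fun k _ => integrable_indicator_Ico_const _ _ _

theorem integrable_stepFun_comp (n : ℕ) (a : ℕ → ℝ) (c : ℝ) {s : ℝ} (hs : 0 < s) :
    Integrable fun x => stepFun n a (c + s * x) :=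
  ((integrable_stepFun n a).comp_add_left c).comp_mul_left' hs.ne'

theorem integral_stepFun_comp (n : ℕ) (a : ℕ → ℝ) (c : ℝ) {s : ℝ} (hs : 0 < s) :
    ∫ x, stepFun n a (c + s * x) = s⁻¹ * ∑ k ∈ Finset.range n, a k := by
  rw [Measure.integral_comp_mul_left (fun x => stepFun n a (c + x)),
    integral_add_left_eq_self (stepFun n a) c, integral_stepFun, abs_of_pos (by positivity),
    smul_eq_mul]

/-! ### Sums of powers of renewal probabilities -/

theorem binomialWeight_nonneg {q : ℝ} (hq0 : 0 ≤ q) (hq1 : q ≤ 1) (k m : ℕ) :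
    0 ≤ binomialWeight q k m := by
  have : 0 ≤ 1 - q := by linarith
  unfold binomialWeight
  positivity

/-- A nonzero weight forces `l ≤ 2k`, so `√l` costs at most a factor `√2` over `√k`. -/
theorem exists_sqrt_mul_binomialWeight_sub_le {q : ℝ} (hq0 : 0 < q) (hq1 : q < 1) :
    ∃ C : ℝ, 0 ≤ C ∧ ∀ l k : ℕ, k ≤ l → √l * binomialWeight q k (l - k) ≤ C := by
  obtain ⟨C, hC⟩ := exists_sqrt_mul_binomialWeight_le hq0 hq1
  have hC0 : 0 ≤ C := by simpa using hC 0 0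
  refine ⟨√2 * C, by positivity, fun l k hk => ?_⟩
  by_cases h : l - k ≤ k
  · calc √l * binomialWeight q k (l - k) ≤ √(2 * k) * binomialWeight q k (l - k) := by
          refine mul_le_mul_of_nonneg_right (Real.sqrt_le_sqrt ?_)
            (binomialWeight_nonneg hq0.le hq1.le _ _)
          exact_mod_cast (by omega : l ≤ 2 * k)
      _ = √2 * (√k * binomialWeight q k (l - k)) := by
          rw [Real.sqrt_mul (by norm_num), mul_assoc]
      _ ≤ √2 * C := by gcongr; exact hC k _
  · rw [binomialWeight, Nat.choose_eq_zero_of_lt (by omega)]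
    simp only [Nat.cast_zero, zero_mul, mul_zero]
    positivity

/-- With `k = ⌊y⌋` one has `l - k - kq = (1+q)((y - k) - √l x)`. The fractional part disappears
after division by `√l`, and `k/l → 1/(1+q)`, so the local limit theorem applies. -/
theorem tendsto_stepFun_binomialWeight {q : ℝ} (hq0 : 0 < q) (hq1 : q < 1) (x : ℝ) :
    Tendsto (fun l : ℕ => stepFun (l + 1) (fun k => √l * binomialWeight q k (l - k))
      (l / (1 + q) + √l * x)) atTop
      (𝓝 (√((1 + q) / (2 * Real.pi * (q * (1 - q)))) *
        Real.exp (-((1 + q) ^ 3 / (2 * (q * (1 - q)))) * x ^ 2))) := by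
  have hμ : 0 < 1 + q := by linarith
  have hv : 0 < q * (1 - q) := mul_pos hq0 (by linarith)
  have hpi := Real.pi_pos
  have hlt : Tendsto (fun l : ℕ => (l : ℝ)) atTop atTop := tendsto_natCast_atTop_atTop
  have hinv : Tendsto (fun l : ℕ => (√(l : ℝ))⁻¹) atTop (𝓝 0) :=
    tendsto_inv_atTop_zero.comp (Real.tendsto_sqrt_atTop.comp hlt)
  set y : ℕ → ℝ := fun l => l / (1 + q) + √l * x with hy
  have hyl : Tendsto (fun l : ℕ => y l / l) atTop (𝓝 (1 + q)⁻¹) := by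
    have := (hinv.mul_const x).const_add ((1 + q)⁻¹)
    rw [zero_mul, add_zero] at this
    refine this.congr' ?_
    filter_upwards [eventually_gt_atTop 0] with l hl
    have hl' : (0 : ℝ) < l := by exact_mod_cast hl
    have := Real.mul_self_sqrt hl'.le
    have hs : √(l : ℝ) ≠ 0 := by positivity
    simp only [hy]
    rw [eq_div_iff hl'.ne', add_mul]
    congr 1
    · ring
    · field_simp
      linear_combination -x * this
  have hyt : Tendsto y atTop atTop := by
    refine (hlt.atTop_mul_pos (inv_pos.2 hμ) hyl).congr' ?_
    filter_upwards [eventually_gt_atTop 0] with l hl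
    exact mul_div_cancel₀ _ (by positivity)
  have hkt : Tendsto (fun l => ⌊y l⌋₊) atTop atTop := tendsto_nat_floor_atTop.comp hyt
  have hkl : Tendsto (fun l : ℕ => (⌊y l⌋₊ : ℝ) / l) atTop (𝓝 (1 + q)⁻¹) := by
    have := (tendsto_nat_floor_div_atTop.comp hyt).mul hyl
    rw [one_mul] at this
    refine this.congr' ?_
    filter_upwards [hyt.eventually_gt_atTop 0] with l hl
    exact div_mul_div_cancel₀ hl.ne'
  have hr : Tendsto (fun l : ℕ => √((⌊y l⌋₊ : ℝ) / l)) atTop (𝓝 (√(1 + q)⁻¹)) :=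
    (Real.continuous_sqrt.tendsto _).comp hkl
  have hr0 : √(1 + q)⁻¹ ≠ 0 := by positivity
  -- Makes the truncated subtraction `l - k` genuine and keeps `k` in the range of the step
  -- function.
  have hle : ∀ᶠ l : ℕ in atTop, ⌊y l⌋₊ ≤ l := by
    filter_upwards [hkl.eventually_lt_const (inv_lt_one_of_one_lt₀ (by linarith : 1 < 1 + q)),
      eventually_gt_atTop 0] with l h1 hl
    rw [div_lt_one (by positivity)] at h1
    exact_mod_cast h1.le
  have hfrac : Tendsto (fun l : ℕ => (y l - ⌊y l⌋₊) * (√(l : ℝ))⁻¹) atTop (𝓝 0) := by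
    refine squeeze_zero' ?_ ?_ hinv
    · filter_upwards [hyt.eventually_gt_atTop 0] with l hl
      exact mul_nonneg (sub_nonneg.2 (Nat.floor_le hl.le)) (by positivity)
    · filter_upwards with l
      exact mul_le_of_le_one_left (by positivity) (by linarith [Nat.lt_floor_add_one (y l)])
  have hz : Tendsto (fun l : ℕ => (((l - ⌊y l⌋₊ : ℕ) : ℝ) - ⌊y l⌋₊ * q) / √(⌊y l⌋₊ : ℝ)) atTop
      (𝓝 (((1 + q) * (0 - x)) / √(1 + q)⁻¹)) := by
    refine (((hfrac.sub_const x).const_mul (1 + q)).div hr hr0).congr' ?_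
    filter_upwards [hle, eventually_gt_atTop 0, hkt.eventually_gt_atTop 0] with l h1 hl hk
    have hl' : (0 : ℝ) < l := by exact_mod_cast hl
    have hk' : (0 : ℝ) < ⌊y l⌋₊ := by exact_mod_cast hk
    have hyl : (1 + q) * y l = l + (1 + q) * (√l * x) := by
      rw [hy]; field_simp
    have hs : √(l : ℝ) ≠ 0 := by positivity
    have hs' : √(⌊y l⌋₊ : ℝ) ≠ 0 := by positivity
    simp only [Pi.div_apply]
    rw [Nat.cast_sub h1, Real.sqrt_div hk'.le]
    field_simp
    linear_combination hyl
  have h := (tendsto_sqrt_mul_binomialWeight hq0 hq1 hkt hz).div hr hr0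
  have hval : (√(2 * Real.pi * (q * (1 - q))))⁻¹ *
      Real.exp (-((1 + q) * (0 - x) / √(1 + q)⁻¹) ^ 2 / (2 * (q * (1 - q)))) / √(1 + q)⁻¹ =
      √((1 + q) / (2 * Real.pi * (q * (1 - q)))) *
        Real.exp (-((1 + q) ^ 3 / (2 * (q * (1 - q)))) * x ^ 2) := by
    have hexp : -((1 + q) * (0 - x) / √(1 + q)⁻¹) ^ 2 / (2 * (q * (1 - q))) =
        -((1 + q) ^ 3 / (2 * (q * (1 - q)))) * x ^ 2 := by
      rw [div_pow, Real.sq_sqrt (by positivity)]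
      field_simp
      ring
    rw [hexp, Real.sqrt_inv, Real.sqrt_div hμ.le, div_inv_eq_mul]
    ring
  rw [hval] at h
  refine h.congr' ?_
  filter_upwards [hle, eventually_gt_atTop 0, hkt.eventually_gt_atTop 0,
    hyt.eventually_gt_atTop 0] with l h1 hl hk hy0
  have hs' : √(⌊y l⌋₊ : ℝ) ≠ 0 := by positivity
  have hs : √(l : ℝ) ≠ 0 := by positivity
  change _ = stepFun (l + 1) _ (y l)
  rw [stepFun, if_pos ⟨hy0.le, by omega⟩, Pi.div_apply, Real.sqrt_div (by positivity)]
  field_simp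

/-- The sums of `N`-th powers of renewal probabilities, from the case `N = 1`. -/
theorem tendsto_sum_binomialWeight_pow {q : ℝ} (hq0 : 0 < q) (hq1 : q < 1)
    (hsum : Tendsto (fun l : ℕ => ∑ k ∈ Finset.range (l + 1), binomialWeight q k (l - k)) atTop
      (𝓝 (1 + q)⁻¹)) {N : ℕ} (hN : 1 ≤ N) :
    Tendsto (fun l : ℕ => (√l)⁻¹ * √l ^ N *
        ∑ k ∈ Finset.range (l + 1), binomialWeight q k (l - k) ^ N) atTop
      (𝓝 (√((1 + q) / (2 * Real.pi * (q * (1 - q)))) ^ N *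
        √(2 * Real.pi * (q * (1 - q)) / (N * (1 + q) ^ 3)))) := by
  have hμ : 0 < 1 + q := by linarith
  have hv : 0 < q * (1 - q) := mul_pos hq0 (by linarith)
  have hpi := Real.pi_pos
  set G : ℝ → ℝ := fun x => √((1 + q) / (2 * Real.pi * (q * (1 - q)))) *
        Real.exp (-((1 + q) ^ 3 / (2 * (q * (1 - q)))) * x ^ 2) with hG
  set g : ℕ → ℝ → ℝ := fun l x => stepFun (l + 1) (fun k => √l * binomialWeight q k (l - k))
      (l / (1 + q) + √l * x) with hg
  have hGpow {M : ℕ} (hM : 1 ≤ M) : ∫ x, G x ^ M =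
      √((1 + q) / (2 * Real.pi * (q * (1 - q)))) ^ M *
        √(2 * Real.pi * (q * (1 - q)) / (M * (1 + q) ^ 3)) := by
    have : ∀ x, G x ^ M = √((1 + q) / (2 * Real.pi * (q * (1 - q)))) ^ M *
        Real.exp (-(M * (1 + q) ^ 3 / (2 * (q * (1 - q)))) * x ^ 2) := fun x => by
      rw [hG, mul_pow, ← Real.exp_nat_mul]
      ring_nf
    simp_rw [this]
    rw [integral_const_mul, integral_gaussian]
    congr 2
    field_simp
  -- The agreement of this value with the limit in `hsum` is what Scheffé's argument needs.
  have hGint : ∫ x, G x = (1 + q)⁻¹ := by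
    have := hGpow le_rfl
    simp only [pow_one, Nat.cast_one, one_mul] at this
    rw [this, ← Real.sqrt_mul (by positivity), Real.sqrt_eq_iff_mul_self_eq (by positivity)
      (by positivity)]
    have : 1 - q ≠ 0 := by linarith
    field_simp
  obtain ⟨C, hC0, hC⟩ := exists_sqrt_mul_binomialWeight_sub_le hq0 hq1
  have hgint {M : ℕ} (hM : 1 ≤ M) {l : ℕ} (hl : 0 < l) : ∫ x, g l x ^ M = (√l)⁻¹ * √l ^ M *
        ∑ k ∈ Finset.range (l + 1), binomialWeight q k (l - k) ^ M := by
    simp_rw [hg, stepFun_pow hM]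
    rw [integral_stepFun_comp _ _ _ (by positivity), mul_assoc, Finset.mul_sum (a := √(l : ℝ) ^ M)]
    simp_rw [mul_pow]
  -- The shift to `l + 1` keeps the scale `√l` positive for the change of variables.
  have hlim := tendsto_integral_pow_of_tendsto_integral (μ := volume) (g := fun l => g (l + 1))
    (G := G) (C := C) ?_ ?_ ?_ ?_ ?_ ?_ hN
  · rw [hGpow hN] at hlim
    rw [← tendsto_add_atTop_iff_nat 1]
    exact hlim.congr fun l => hgint hN (Nat.succ_pos l)
  · intro l x
    simp only [hg, stepFun]
    split_ifs
    · exact mul_nonneg (Real.sqrt_nonneg _) (binomialWeight_nonneg hq0.le hq1.le _ _)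
    · exact le_rfl
  · intro l x
    simp only [hg, stepFun]
    split_ifs with h
    · exact hC _ _ (by omega)
    · exact hC0
  · exact (integrable_exp_neg_mul_sq (by positivity)).const_mul _
  · exact fun l => integrable_stepFun_comp _ _ _ (Real.sqrt_pos.2 (by positivity))
  · exact fun x => (tendsto_add_atTop_iff_nat (f := fun l => g l x) 1).2
      (tendsto_stepFun_binomialWeight hq0 hq1 x)
  · rw [hGint]
    refine ((tendsto_add_atTop_iff_nat 1).2 hsum).congr fun l => ?_
    have h := hgint le_rfl (Nat.succ_pos l)
    have : √((l + 1 : ℕ) : ℝ) ≠ 0 := by positivity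
    simp only [pow_one] at h
    rw [h, inv_mul_cancel₀ this, one_mul]

/-! ### The golden ratio and the explicit constant -/

/-- As `1 - φ² = φ`, the total exponent of `φ` is `(k - (l-k)) + 2(l-k) = l`. -/
theorem binomialWeight_of_sq_eq {φ : ℝ} (h : φ ^ 2 = 1 - φ) {k l : ℕ} (hk : k ≤ l) :
    binomialWeight (φ ^ 2) k (l - k) = φ ^ l * k.choose (l - k) := by
  rcases le_or_gt (l - k) k with h1 | h1
  · rw [binomialWeight, show 1 - φ ^ 2 = φ by linarith, mul_assoc, ← pow_mul, ← pow_add, mul_comm]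
    congr 2
    omega
  · rw [binomialWeight, Nat.choose_eq_zero_of_lt h1]
    simp

theorem tendsto_pow_mul_fib_succ :
    Tendsto (fun l : ℕ => (-Real.goldenConj) ^ l * (Nat.fib (l + 1) : ℝ)) atTop
      (𝓝 (Real.goldenRatio / √5)) := by
  have hψ := Real.goldenConj_neg
  have hψ1 := Real.neg_one_lt_goldenConj
  have h : Tendsto (fun l : ℕ => (-(Real.goldenConj ^ 2)) ^ l) atTop (𝓝 0) := by
    refine tendsto_pow_atTop_nhds_zero_of_abs_lt_one ?_
    rw [abs_neg, abs_pow, sq_lt_one_iff₀ (abs_nonneg _), abs_lt]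
    constructor <;> linarith
  have h2 := ((h.const_mul Real.goldenConj).const_sub Real.goldenRatio).div_const √5
  rw [mul_zero, sub_zero] at h2
  refine h2.congr fun l => ?_
  rw [Real.coe_fib_eq]
  have h3 : (-Real.goldenConj) ^ l * Real.goldenRatio ^ l = 1 := by
    rw [← mul_pow, neg_mul, Real.goldenConj_mul_goldenRatio, neg_neg, one_pow]
  have h4 : (-(Real.goldenConj ^ 2)) ^ l = (-Real.goldenConj) ^ l * Real.goldenConj ^ l := by
    rw [← mul_pow]; ring_nf
  rw [h4, pow_succ, pow_succ]
  linear_combination -(Real.goldenRatio / √5) * h3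

/-- The renewal theorem for mean step `1 + φ²`, obtained from Binet's formula because the diagonal
sums of binomial coefficients are Fibonacci numbers. -/
theorem tendsto_sum_pow_mul_choose {φ : ℝ} (hφ : φ = (√5 - 1) / 2) :
    Tendsto (fun l : ℕ => ∑ k ∈ Finset.range (l + 1), binomialWeight (φ ^ 2) k (l - k)) atTop
      (𝓝 (1 + φ ^ 2)⁻¹) := by
  have h5 : √5 ^ 2 = (5 : ℝ) := Real.sq_sqrt (by norm_num)
  have hsq : φ ^ 2 = 1 - φ := by rw [hφ]; linear_combination h5 / 4
  have hconj : -Real.goldenConj = φ := by rw [hφ, Real.goldenConj]; ring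
  have h := tendsto_pow_mul_fib_succ
  rw [hconj] at h
  convert h using 2 with l
  · rw [Nat.fib_succ_eq_sum_choose, Finset.Nat.sum_antidiagonal_eq_sum_range_succ_mk]
    push_cast
    rw [Finset.mul_sum]
    exact Finset.sum_congr rfl fun k hk =>
      binomialWeight_of_sq_eq hsq (by simp at hk; omega)
  · have : 0 < √(5 : ℝ) := by positivity
    rw [Real.goldenRatio, eq_div_iff this.ne', inv_mul_eq_iff_eq_mul₀ (by positivity), hφ]
    linear_combination (-√5 / 8 + 1 / 8) * h5

/-- Since `φ(1+φ) = 1`, the quantity `-φA` collapses to `1 + φ²` for every `N`, and the base of the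
power in `h` to `φ³/(1+φ²)`. Squaring then removes the roots. -/
theorem coefficient_eq {N : ℕ} (hN : 1 ≤ N) {φ A h b₀ : ℝ} (h0 : 0 < φ) (hsq : φ ^ 2 = 1 - φ)
    (hA : A = -(φ ^ (N - 1) * (1 + φ) ^ (N - 1) * (1 + 2 * φ)))
    (hh : h = N * (φ / (1 + 3 * φ + 2 * φ ^ 2)) ^ (N - 1))
    (hb₀ : b₀ = 1 / (-φ * A * √((2 * Real.pi) ^ (N - 1) * h))) :
    √((1 + φ ^ 2) / (2 * Real.pi * (φ ^ 2 * (1 - φ ^ 2)))) ^ N *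
      √(2 * Real.pi * (φ ^ 2 * (1 - φ ^ 2)) / (N * (1 + φ ^ 2) ^ 3)) = b₀ := by
  have hpi := Real.pi_pos
  have hN' : (0 : ℝ) < N := by exact_mod_cast hN
  have hv : 1 - φ ^ 2 = φ := by linarith
  have hφ1 : φ * (1 + φ) = 1 := by linarith
  have hA' : -φ * A = 1 + φ ^ 2 := by
    rw [hA, ← mul_pow, hφ1, one_pow]
    linear_combination hsq
  have hden : φ / (1 + 3 * φ + 2 * φ ^ 2) = (φ ^ 2 * φ) / (1 + φ ^ 2) := by
    rw [div_eq_div_iff (by positivity) (by positivity)]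
    linear_combination (-φ - φ ^ 2 - 2 * φ ^ 3) * hsq
  rw [hb₀, hA', hh, hv, hden]
  obtain ⟨M, rfl⟩ := Nat.exists_eq_add_of_le' hN
  rw [Nat.add_sub_cancel]
  rw [← pow_left_inj₀ (by positivity) (by positivity) two_ne_zero, mul_pow, ← pow_mul,
    mul_comm (M + 1) 2, pow_mul, Real.sq_sqrt (by positivity), Real.sq_sqrt (by positivity),
    div_pow 1, mul_pow (1 + φ ^ 2) (√_), Real.sq_sqrt (by positivity)]
  rw [pow_succ, div_pow, div_pow, mul_pow]
  field_simp

theorem theorem4 (N : ℕ) (hN : 1 ≤ N) (φ A h b₀ : ℝ)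
    (hφ : φ = (Real.sqrt 5 - 1) / 2)
    (hA : A = -(φ ^ (N - 1) * (1 + φ) ^ (N - 1) * (1 + 2 * φ)))
    (hh : h = N * (φ / (1 + 3 * φ + 2 * φ ^ 2)) ^ (N - 1))
    (hb₀ : b₀ = 1 / (-φ * A * Real.sqrt ((2 * Real.pi) ^ (N - 1) * h))) :
    (∀ len : Fin N → ℕ, (alignments (oneTwoSteps N) len).Finite) ∧
    Asymptotics.IsEquivalent Filter.atTop
      (fun l : ℕ => (numAlignments (oneTwoSteps N) (fun _ => l) : ℝ))
      (fun l : ℕ => φ ^ (-((l : ℤ) * (N : ℤ))) * b₀ * (l : ℝ) ^ ((1 - (N : ℝ)) / 2)) := by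
  refine ⟨finite_alignments_oneTwoSteps hN, ?_⟩
  have h5 : √5 ^ 2 = (5 : ℝ) := Real.sq_sqrt (by norm_num)
  have hsq : φ ^ 2 = 1 - φ := by rw [hφ]; linear_combination h5 / 4
  have h0 : 0 < φ := by
    have : 1 < √(5 : ℝ) := Real.lt_sqrt_of_sq_lt (by norm_num)
    linarith
  have hlim := tendsto_sum_binomialWeight_pow (q := φ ^ 2) (by positivity) (by linarith)
    (tendsto_sum_pow_mul_choose hφ) hN
  have hb := coefficient_eq hN h0 hsq hA hh hb₀
  have hN' : (0 : ℝ) < N := by exact_mod_cast hN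
  have hbpos : b₀ ≠ 0 := by
    rw [← hb, show 1 - φ ^ 2 = φ by linarith]
    have := Real.pi_pos
    positivity
  rw [hb] at hlim
  have hequiv := (Asymptotics.IsEquivalent.refl (l := atTop) (u := fun l : ℕ =>
    φ ^ (-((l : ℤ) * (N : ℤ))) * (l : ℝ) ^ ((1 - (N : ℝ)) / 2))).mul
    ((Asymptotics.isEquivalent_const_iff_tendsto hbpos).2 hlim)
  refine (hequiv.congr_left ?_).congr_right (.of_forall fun l => ?_)
  · filter_upwards [eventually_gt_atTop 0] with l hl
    have hl' : (0 : ℝ) < l := by exact_mod_cast hl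
    have hpow : (l : ℝ) ^ ((1 - (N : ℝ)) / 2) * ((√l)⁻¹ * √l ^ N) = 1 := by
      rw [Real.sqrt_eq_rpow, ← Real.rpow_neg hl'.le, ← Real.rpow_natCast, ← Real.rpow_mul hl'.le,
        ← Real.rpow_add hl', ← Real.rpow_add hl']
      ring_nf
      exact Real.rpow_zero _
    have hzpow : φ ^ (-((l : ℤ) * (N : ℤ))) * φ ^ (l * N) = 1 := by
      rw [← zpow_natCast φ (l * N), ← zpow_add₀ h0.ne']
      push_cast
      rw [neg_add_cancel, zpow_zero]
    have hsum : ∑ k ∈ Finset.range (l + 1), binomialWeight (φ ^ 2) k (l - k) ^ N =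
        φ ^ (l * N) * numAlignments (oneTwoSteps N) (fun _ => l) := by
      rw [numAlignments_oneTwoSteps hN hl]
      push_cast
      rw [Finset.mul_sum]
      refine Finset.sum_congr rfl fun k hk => ?_
      rw [binomialWeight_of_sq_eq hsq (by simp at hk; omega), mul_pow, pow_mul]
    simp only [Pi.mul_apply]
    rw [hsum]
    linear_combination (numAlignments (oneTwoSteps N) (fun _ => l) : ℝ) *
      (φ ^ (-((l : ℤ) * (N : ℤ))) * φ ^ (l * N) * hpow + hzpow)
  · simp only [Pi.mul_apply, Function.const_apply]
    ring
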